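/- **Setting.** Let $a_i,b_i>0$ ($i\ge 1$) be the coagulation and fragmentation coefficients of the Becker–Döring equations, and let $Q_1=1$, $Q_{i+1}=\frac{a_i}{b_{i+1}}Q_i$ be the detailed balance coefficients. Let $z_s\in[0,\infty]$ be the largest number such that $\sum_{i\ge1} iQ_iz^i<\infty$ for all $0\le z<z_s$, and let $\varrho_s=\sum_{i\ge1} iQ_iz_s^i\in[0,\infty]$. Assume: 1. $0<z_s<\infty$; 2. $Q_i=z_s^{1-i}\alpha_i$ for all $i\ge1$, where $(\alpha_i)$ is positive, non-increasing and $\lim_{i\to\infty}\alpha_{i+1}/\alpha_i=1$; 3. there are $\gamma\in[0,1]$ and $C_1,C_2>0$ with $C_1i^\gamma\le a_i\le C_2i^\gamma$ for all $i\ge1$. Let $0<\varrho<\varrho_s$. There is a unique $\overline z\ge0$ with $\sum_{i\ge1} iQ_i\overline z^{\,i}=\varrho$; put $\mathcal Q_i=Q_i\overline z^{\,i}$. For a positive sequence $\mathbf c=(c_i)_{i\ge1}$ of mass $\sum_{i\ge1} ic_i=\varrho$ define $$\overline D(\mathbf c)=\sum_{i\ge1}a_iQ_i\Big(\sqrt{\tfrac{c_1c_i}{Q_i}}-\sqrt{\tfrac{c_{i+1}}{Q_{i+1}}}\Big)^2,\qquad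 H(\mathbf c|\mathcal Q)=\sum_{i\ge1}c_i\Big(\log\frac{c_i}{\overline z^{\,i}Q_i}-1\Big)+\sum_{i\ge1}\overline z^{\,i}Q_i,$$ and $M_\beta(\mathbf c)=\sum_{i\ge1}i^\beta c_i$. All the series defining $\overline D(\mathbf c)$ and $H(\mathbf c|\mathcal Q)$ converge. **Theorem 1.1.** (i) Let $\gamma=1$ and $\delta>0$. There is $K>0$, depending only on $\delta,z_s,\varrho,(\alpha_i)$ and $C_1$, such that $$\overline D(\mathbf c)\ge K\,H(\mathbf c|\mathcal Q)$$ for every positive $\mathbf c$ of mass $\varrho$ with $\delta<c_1<z_s-\delta$. (ii) Let $0\le\gamma<1$, $\delta>0$, $\beta>1$ and $M\in\mathbb R$. There is $K>0$, depending only on $\delta,z_s,\varrho,M,(\alpha_i),C_1,\gamma$ and $\beta$, such that $$\overline D(\mathbf c)\ge K\,H(\mathbf c|\mathcal Q)^{\frac{\beta-\gamma}{\beta-1}}$$ for every positive $\mathbf c$ of mass $\varrho$ with $\delta<c_1<z_s-\delta$ and $M_\beta(\mathbf c)\le M$. (iii) There is $\delta_0>0$, depending only on $\varrho$ and $(Q_i)$,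 such that the following holds for every $0<\delta\le\delta_0$. * If $\gamma=1$, there is $\varepsilon>0$, depending only on $\delta,z_s,\varrho,(\alpha_i)$ and $C_1$, such that $\overline D(\mathbf c)\ge\varepsilon$ for every positive $\mathbf c$ of mass $\varrho$ with $c_1\le\delta$ or $c_1\ge z_s-\delta$. * If $0\le\gamma<1$, $\beta>1$ and $M\in\mathbb R$, there is $\varepsilon>0$, depending only on $\delta,z_s,\varrho,M,(\alpha_i),C_1,\gamma$ and $\beta$, such that $\overline D(\mathbf c)\ge\varepsilon$ for every positive $\mathbf c$ of mass $\varrho$ with $M_\beta(\mathbf c)\le M$ and with $c_1\le\delta$ or $c_1\ge z_s-\delta$. -/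

import Mathlib

open Filter Topology
open scoped ENNReal NNReal

namespace BeckerDoring

/-! Sequences indexed by the positive integers are functions on `ℕ+`. -/

/-- `Q` is the sequence of detailed balance coefficients of the Becker-Döring equations with
coagulation coefficients `a` and fragmentation coefficients `b`:
`Q 1 = 1` and `Q (i + 1) = (a i / b (i + 1)) * Q i`. -/
structure IsDetailedBalance (a b Q : ℕ+ → ℝ) : Prop where
  one : Q 1 = 1
  succ : ∀ i : ℕ+, Q (i + 1) = a i / b (i + 1) * Q i

/-- The mass `∑ i Q_i z^i`, in `[0, ∞]`, of the formal equilibrium `(Q_i z^i)_i`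
(for a nonnegative sequence `Q`). -/
noncomputable def equilibriumMass (Q : ℕ+ → ℝ) (z : ℝ≥0∞) : ℝ≥0∞ :=
  ∑' i : ℕ+, ((i : ℕ) : ℝ≥0∞) * ENNReal.ofReal (Q i) * z ^ (i : ℕ)

/-- The critical monomer density `z_s ∈ [0, ∞]`: the largest `z` such that
`∑ i Q_i w^i < ∞` for all `0 ≤ w < z`. -/
noncomputable def criticalMonomerDensity (Q : ℕ+ → ℝ) : ℝ≥0∞ :=
  sSup {z : ℝ≥0∞ | ∀ w : ℝ≥0∞, w < z → equilibriumMass Q w < ⊤}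

/-- The critical mass `ϱ_s = ∑ i Q_i z_s^i ∈ [0, ∞]`. -/
noncomputable def criticalMass (Q : ℕ+ → ℝ) : ℝ≥0∞ :=
  equilibriumMass Q (criticalMonomerDensity Q)

/-- `Q i = z_s^(1 - i) * α i`, with `α` positive, non-increasing and `α (i + 1) / α i → 1`. -/
structure HasTypicalForm (Q α : ℕ+ → ℝ) (zs : ℝ) : Prop where
  eq : ∀ i : ℕ+, Q i = zs ^ (1 - ((i : ℕ) : ℤ)) * α i
  pos : ∀ i : ℕ+, 0 < α i
  antitone : Antitone α
  tendsto_ratio : Tendsto (fun i : ℕ+ => α (i + 1) / α i) atTop (𝓝 1)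

/-- `a` and `b` are positive coagulation and fragmentation coefficients with detailed balance
coefficients `Q`, and `C₁ i^γ ≤ a i ≤ C₂ i^γ` for all `i`, with the given `C₁` and for some
constant `C₂ > 0`. -/
structure IsAdmissible (Q : ℕ+ → ℝ) (γ C₁ : ℝ) (a b : ℕ+ → ℝ) : Prop where
  coag_pos : ∀ i : ℕ+, 0 < a i
  frag_pos : ∀ i : ℕ+, 0 < b i
  detailedBalance : IsDetailedBalance a b Q
  lower : ∀ i : ℕ+, C₁ * ((i : ℕ) : ℝ) ^ γ ≤ a i
  upper : ∃ C₂ : ℝ, 0 < C₂ ∧ ∀ i : ℕ+, a i ≤ C₂ * ((i : ℕ) : ℝ) ^ γ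

/-- `c` is a positive sequence with (finite) mass `∑ i c_i = ϱ`. -/
structure IsPositiveWithMass (c : ℕ+ → ℝ) (ϱ : ℝ) : Prop where
  pos : ∀ i : ℕ+, 0 < c i
  mass : HasSum (fun i : ℕ+ => ((i : ℕ) : ℝ) * c i) ϱ

/-- The moment of order `β` of `c` is finite and at most `M`. -/
structure MomentLE (c : ℕ+ → ℝ) (β M : ℝ) : Prop where
  summable : Summable (fun i : ℕ+ => ((i : ℕ) : ℝ) ^ β * c i)
  le : ∑' i : ℕ+, ((i : ℕ) : ℝ) ^ β * c i ≤ M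

/-- `z` is an equilibrium monomer density for the mass `ϱ`. -/
structure IsEquilibriumDensity (Q : ℕ+ → ℝ) (ϱ z : ℝ) : Prop where
  nonneg : 0 ≤ z
  mass : HasSum (fun i : ℕ+ => ((i : ℕ) : ℝ) * Q i * z ^ (i : ℕ)) ϱ

/-- The general term of the lower free energy dissipation. -/
noncomputable def lowerDissipationTerm (a Q c : ℕ+ → ℝ) (i : ℕ+) : ℝ :=
  a i * Q i * (√(c 1 * c i / Q i) - √(c (i + 1) / Q (i + 1))) ^ 2

/-- The lower free energy dissipation of `c`. -/
noncomputable def lowerDissipation (a Q c : ℕ+ → ℝ) : ℝ :=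
  ∑' i : ℕ+, lowerDissipationTerm a Q c i

/-- The general term of the first series in the relative free energy. -/
noncomputable def freeEnergyTerm (Q : ℕ+ → ℝ) (z : ℝ) (c : ℕ+ → ℝ) (i : ℕ+) : ℝ :=
  c i * (Real.log (c i / (z ^ (i : ℕ) * Q i)) - 1)

/-- The free energy of `c` relative to the equilibrium `(Q_i z^i)_i`. -/
noncomputable def relativeFreeEnergy (Q : ℕ+ → ℝ) (z : ℝ) (c : ℕ+ → ℝ) : ℝ :=
  ∑' i : ℕ+, freeEnergyTerm Q z c i + ∑' i : ℕ+, z ^ (i : ℕ) * Q i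

end BeckerDoring

/-! Put `v i = √(c i / Q i) - √(c 1) ^ i`. The dissipation is a weighted sum of the squared defects
in the recursion `v (i + 1) = √(c 1) * v i - rootFlux Q c i`. The squared Hellinger distance `Q i *
v i ^ 2` between `c i` and the equilibrium value `c 1 ^ i * Q i` vanishes at `i = 1`. Since `zs * Q
(i + 1) ≤ Q i`, it contracts, up to the defects, by a factor as close to `c 1 / zs` as desired
(`hellinger_succ_le`). For `c 1 < zs - δ`, a discrete Hardy inequality (`weighted_hardy`) then
bounds its moment of order `γ` by the dissipation.

The equilibrium of mass `ϱ` minimizes the free energy of `c` among all subcritical equilibria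
(`relativeFreeEnergy_le`), so it may be replaced by the one with monomer density `c 1`. The entropy
density is at most a logarithm times the squared Hellinger distance, and the logarithm is at most
linear in `i`, so the first moment of that distance controls the free energy. This suffices for `γ =
1`. For `γ < 1`, interpolation with the moment of order `β` produces the exponent.

When `c 1` is extreme, small dissipation would force finitely many `c i` towards `c 1 ^ i * Q i`,
whose mass is too large or too small to be compatible with `ϱ`. For small `c 1` the tail is
controlled by the moment; if `γ = 1`, a direct weighted sum replaces this argument. -/

namespace BeckerDoring

/-! ### Entropy, Hardy and interpolation inequalities -/

section Preliminaries

lemma hasSum_pnat_shift {f : ℕ+ → ℝ} {s : ℝ} (h : HasSum f s) :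
    HasSum (fun i : ℕ+ => f (i + 1)) (s - f 1) := by
  have h1 : HasSum (fun n : ℕ => f n.succPNat) s := Equiv.pnatEquivNat.symm.hasSum_iff.mpr h
  have h2 : HasSum (fun n : ℕ => f (n + 1).succPNat) (s - f 1) := by
    simpa only [Finset.sum_range_one] using! (hasSum_nat_add_iff' 1).mpr h1
  exact Equiv.pnatEquivNat.symm.hasSum_iff.mp h2

lemma summable_pow_mul_geometric_pnat (k : ℕ) {r : ℝ} (h0 : 0 ≤ r) (h1 : r < 1) :
    Summable (fun i : ℕ+ => ((i : ℕ) : ℝ) ^ k * r ^ (i : ℕ)) := by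
  have h : Summable (fun n : ℕ => (n : ℝ) ^ k * r ^ n) :=
    summable_pow_mul_geometric_of_norm_lt_one k (by rwa [Real.norm_of_nonneg h0])
  exact h.comp_injective PNat.coe_injective

lemma one_le_cast (i : ℕ+) : (1 : ℝ) ≤ ((i : ℕ) : ℝ) := Nat.one_le_cast.mpr i.pos

lemma cast_pos (i : ℕ+) : (0 : ℝ) < ((i : ℕ) : ℝ) := by exact_mod_cast i.pos

lemma cast_succ (i : ℕ+) : (((i + 1 : ℕ+) : ℕ) : ℝ) = ((i : ℕ) : ℝ) + 1 := by push_cast; ring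

/-- The integrand `x log x - x + 1` of the relative entropy is controlled by `(√x - 1)²` up to a
logarithmic factor. -/
lemma entropy_le {t : ℝ} (ht : 0 < t) :
    t ^ 2 * Real.log (t ^ 2) - t ^ 2 + 1 ≤ (4 + max 0 (Real.log (t ^ 2))) * (t - 1) ^ 2 := by
  rcases le_total t 1 with h | h
  · have h2 := Real.log_le_sub_one_of_pos (pow_pos ht 2)
    have h3 : t ^ 2 * Real.log (t ^ 2) ≤ t ^ 2 * (t ^ 2 - 1) := by gcongr
    have h4 : 4 * (t - 1) ^ 2 ≤ (4 + max 0 (Real.log (t ^ 2))) * (t - 1) ^ 2 := by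
      gcongr; linarith [le_max_left 0 (Real.log (t ^ 2))]
    have h5 : (t + 1) ^ 2 * (t - 1) ^ 2 ≤ 4 * (t - 1) ^ 2 := by
      gcongr; nlinarith
    nlinarith
  · have h2 := Real.log_le_sub_one_of_pos ht
    have h3 : (4 + Real.log (t ^ 2)) * (t - 1) ^ 2
        ≤ (4 + max 0 (Real.log (t ^ 2))) * (t - 1) ^ 2 := by
      gcongr; exact le_max_right _ _
    have h4 : Real.log (t ^ 2) = 2 * Real.log t := by rw [Real.log_pow]; norm_num
    -- Removing `log (t ^ 2) * (t - 1) ^ 2` from the left side leaves `2 * (2 * t - 1) * log t - t ^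
    -- 2 + 1`, which is then at most `3 * (t - 1) ^ 2`.
    have h5 : (2 * t - 1) * Real.log t ≤ (2 * t - 1) * (t - 1) := by gcongr; linarith
    refine le_trans ?_ h3
    rw [h4]
    nlinarith [sq_nonneg (t - 1)]

lemma relativeEntropy_le {x m : ℝ} (hx : 0 < x) (hm : 0 < m) :
    x * (Real.log (x / m) - 1) + m ≤ (4 + max 0 (Real.log (x / m))) * (√x - √m) ^ 2 := by
  have hxm : 0 < x / m := div_pos hx hm
  have h := entropy_le (Real.sqrt_pos.mpr hxm)
  rw [Real.sq_sqrt hxm.le] at h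
  have hs : (√x - √m) ^ 2 = m * (√(x / m) - 1) ^ 2 := by
    rw [Real.sqrt_div hx.le]
    have : √m ≠ 0 := (Real.sqrt_pos.mpr hm).ne'
    nth_rewrite 2 [← Real.sq_sqrt hm.le]
    field_simp
  have h' := mul_le_mul_of_nonneg_left h hm.le
  have e : m * (x / m) = x := by field_simp
  rw [hs]
  calc x * (Real.log (x / m) - 1) + m
      = m * (x / m * Real.log (x / m) - x / m + 1) := by
        linear_combination (-(Real.log (x / m)) + 1) * e
    _ ≤ _ := h'
    _ = _ := by ring

lemma relativeEntropy_nonneg {x m : ℝ} (hx : 0 < x) (hm : 0 < m) :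
    0 ≤ x * (Real.log (x / m) - 1) + m := by
  have h := Real.log_le_sub_one_of_pos (div_pos hm hx)
  have e : Real.log (x / m) = - Real.log (m / x) := by rw [← Real.log_inv, inv_div]
  have h' := mul_le_mul_of_nonneg_left h hx.le
  have e2 : x * (m / x - 1) = m - x := by field_simp
  rw [e]; linarith

lemma sq_sqrt_sub_sqrt_le {x m : ℝ} (hx : 0 ≤ x) (hm : 0 ≤ m) : (√x - √m) ^ 2 ≤ x + m := by
  have := mul_nonneg (Real.sqrt_nonneg x) (Real.sqrt_nonneg m)
  nlinarith [Real.sq_sqrt hx, Real.sq_sqrt hm]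

/-- Young's inequality for the square of a difference. -/
lemma sub_sq_le_young {x y ε : ℝ} (hε : 0 < ε) :
    (x - y) ^ 2 ≤ (1 + ε) * x ^ 2 + (1 + 1 / ε) * y ^ 2 := by
  have : 0 ≤ (ε * x + y) ^ 2 / ε := by positivity
  have e : (ε * x + y) ^ 2 / ε = ε * x ^ 2 + 2 * x * y + 1 / ε * y ^ 2 := by field_simp; ring
  nlinarith

lemma add_rpow_le {γ m t : ℝ} (hγ0 : 0 ≤ γ) (hγ1 : γ ≤ 1) (hm : 0 < m) (ht : 0 ≤ t) :
    (t + 1 + m) ^ γ ≤ (1 + 1 / m) * (t + m) ^ γ := by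
  have h1 : t + 1 + m ≤ (1 + 1 / m) * (t + m) := by
    have : 0 ≤ t / m := by positivity
    have e : (1 + 1 / m) * (t + m) = t + 1 + m + t / m := by field_simp; ring
    linarith
  have h2 : (1 : ℝ) ≤ 1 + 1 / m := by have : 0 < 1 / m := by positivity
                                      linarith
  calc (t + 1 + m) ^ γ ≤ ((1 + 1 / m) * (t + m)) ^ γ := by gcongr
    _ = (1 + 1 / m) ^ γ * (t + m) ^ γ := Real.mul_rpow (by positivity) (by positivity)
    _ ≤ (1 + 1 / m) * (t + m) ^ γ := by
      gcongr
      exact (Real.rpow_le_rpow_of_exponent_le h2 hγ1).trans_eq (Real.rpow_one _)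

/-- A discrete Hardy inequality: a sequence that starts from `0` and contracts up to the increments
`d` is controlled by `d` in the weighted sums with weight `i ^ γ`, `0 ≤ γ ≤ 1`. -/
lemma weighted_hardy {γ θ : ℝ} (hγ0 : 0 ≤ γ) (hγ1 : γ ≤ 1) (hθ0 : 0 ≤ θ) (hθ1 : θ < 1)
    {p d : ℕ+ → ℝ} (hp : ∀ i, 0 ≤ p i) (hd : ∀ i, 0 ≤ d i) (hp1 : p 1 = 0)
    (hrec : ∀ i, p (i + 1) ≤ θ * p i + d i)
    (hps : Summable fun i : ℕ+ => ((i : ℕ) : ℝ) ^ γ * p i)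
    (hds : Summable fun i : ℕ+ => ((i : ℕ) : ℝ) ^ γ * d i) :
    ∑' i : ℕ+, ((i : ℕ) : ℝ) ^ γ * p i ≤
      2 / (1 - θ) * (1 + 2 / (1 - θ)) ^ 2 * ∑' i : ℕ+, ((i : ℕ) : ℝ) ^ γ * d i := by
  have h1θ : 0 < 1 - θ := by linarith
  -- The weight `i ^ γ` can grow by a factor up to `2` in one step, which may destroy the
  -- contraction. The shifted weight `(i + m) ^ γ` grows by at most `1 + 1 / m`, and this `m` keeps
  -- `(1 + 1 / m) * θ` below `(1 + θ) / 2 < 1`.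
  obtain ⟨m, hm⟩ : ∃ m : ℝ, m = 2 / (1 - θ) := ⟨_, rfl⟩
  have hm0 : 0 < m := by rw [hm]; positivity
  rw [← hm]
  have hmm : (1 + 1 / m) * θ ≤ (1 + θ) / 2 := by
    have : 1 / m = (1 - θ) / 2 := by rw [hm]; field_simp
    rw [this]; nlinarith
  have hm2 : 1 ≤ m := by rw [hm, le_div_iff₀ h1θ]; linarith
  have hmi : 1 / m ≤ 1 := by rw [div_le_one hm0]; exact hm2
  set W : ℕ+ → ℝ := fun i => (((i : ℕ) : ℝ) + m) ^ γ with hW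
  have hW0 : ∀ i, 0 ≤ W i := fun i => Real.rpow_nonneg (by positivity) _
  have hW1 : ∀ i : ℕ+, ((i : ℕ) : ℝ) ^ γ ≤ W i := fun i =>
    Real.rpow_le_rpow (by positivity) (by linarith) hγ0
  have hW2 : ∀ i : ℕ+, W i ≤ (1 + m) * ((i : ℕ) : ℝ) ^ γ := fun i => by
    have := one_le_cast i
    calc W i ≤ ((1 + m) * ((i : ℕ) : ℝ)) ^ γ :=
          Real.rpow_le_rpow (by positivity) (by nlinarith) hγ0
      _ = (1 + m) ^ γ * ((i : ℕ) : ℝ) ^ γ := Real.mul_rpow (by positivity) (by positivity)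
      _ ≤ _ := by
        gcongr
        exact (Real.rpow_le_rpow_of_exponent_le (by linarith) hγ1).trans_eq (Real.rpow_one _)
  have hW3 : ∀ i : ℕ+, W (i + 1) ≤ (1 + 1 / m) * W i := fun i => by
    simp only [hW, cast_succ]
    exact add_rpow_le hγ0 hγ1 hm0 (by positivity)
  have hsW : ∀ {q : ℕ+ → ℝ}, (∀ i, 0 ≤ q i) → (Summable fun i : ℕ+ => ((i : ℕ) : ℝ) ^ γ * q i) →
      Summable fun i => W i * q i := fun {q} hq hs =>
    Summable.of_nonneg_of_le (fun i => mul_nonneg (hW0 i) (hq i))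
      (fun i => by
        have := mul_le_mul_of_nonneg_right (hW2 i) (hq i)
        rwa [mul_assoc] at this) (hs.mul_left (1 + m))
  have sp := hsW hp hps
  have sd := hsW hd hds
  have shift := hasSum_pnat_shift sp.hasSum
  simp only [hp1, mul_zero, sub_zero] at shift
  -- As `p 1 = 0`, the shifted sum is the whole sum; being finite, it can be absorbed on the left.
  have key : ∑' i, W i * p i ≤ (1 + θ) / 2 * (∑' i, W i * p i) + 2 * ∑' i, W i * d i := by
    refine hasSum_le (fun i => ?_) shift
      ((sp.hasSum.mul_left ((1 + θ) / 2)).add (sd.hasSum.mul_left 2))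
    calc W (i + 1) * p (i + 1) ≤ ((1 + 1 / m) * W i) * (θ * p i + d i) := by
          have := hW0 i
          exact mul_le_mul (hW3 i) (hrec i) (hp _) (by positivity)
      _ = (1 + 1 / m) * θ * (W i * p i) + (1 + 1 / m) * (W i * d i) := by ring
      _ ≤ _ := by
        have h1 := mul_nonneg (hW0 i) (hp i)
        have h2 := mul_nonneg (hW0 i) (hd i)
        gcongr
        linarith
  have hd' : ∑' i, W i * d i ≤ (1 + m) * ∑' i : ℕ+, ((i : ℕ) : ℝ) ^ γ * d i := by
    refine hasSum_le (fun i => ?_) sd.hasSum (hds.hasSum.mul_left (1 + m))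
    rw [← mul_assoc]
    exact mul_le_mul_of_nonneg_right (hW2 i) (hd i)
  have hp' : ∑' i : ℕ+, ((i : ℕ) : ℝ) ^ γ * p i ≤ ∑' i, W i * p i :=
    hps.tsum_le_tsum (fun i => mul_le_mul_of_nonneg_right (hW1 i) (hp i)) sp
  have hpos : 0 ≤ ∑' i : ℕ+, ((i : ℕ) : ℝ) ^ γ * d i :=
    tsum_nonneg fun i => mul_nonneg (by positivity) (hd i)
  have hk : ∑' i, W i * p i ≤ m * (2 * ((1 + m) * ∑' i : ℕ+, ((i : ℕ) : ℝ) ^ γ * d i)) := by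
    have hmθ : m * (1 - θ) = 2 := by rw [hm]; field_simp
    have : (1 - θ) / 2 * (∑' i, W i * p i) ≤ 2 * ((1 + m) * ∑' i : ℕ+, ((i : ℕ) : ℝ) ^ γ * d i) := by
      linarith
    calc ∑' i, W i * p i = m * ((1 - θ) / 2 * (∑' i, W i * p i)) := by
          linear_combination (-(∑' i, W i * p i) / 2) * hmθ
      _ ≤ _ := by gcongr
  refine hp'.trans (hk.trans ?_)
  have : m * (2 * (1 + m)) ≤ m * (1 + m) ^ 2 := by gcongr; nlinarith
  nlinarith

/-- Interpolation between the moments of orders `γ < 1 < β`. -/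
lemma moment_interpolation {γ β : ℝ} (hγ : γ < 1) (hβ : 1 < β) {p : ℕ+ → ℝ} (hp : ∀ i, 0 ≤ p i)
    (hγs : Summable fun i : ℕ+ => ((i : ℕ) : ℝ) ^ γ * p i)
    (hβs : Summable fun i : ℕ+ => ((i : ℕ) : ℝ) ^ β * p i) :
    ∑' i : ℕ+, ((i : ℕ) : ℝ) * p i ≤
      (∑' i : ℕ+, ((i : ℕ) : ℝ) ^ γ * p i) ^ ((β - 1) / (β - γ)) *
      (∑' i : ℕ+, ((i : ℕ) : ℝ) ^ β * p i) ^ ((1 - γ) / (β - γ)) := by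
  have hβγ : 0 < β - γ := by linarith
  have h1 : 0 < β - 1 := by linarith
  have h2 : 0 < 1 - γ := by linarith
  set s := (β - 1) / (β - γ) with hs
  set t := (1 - γ) / (β - γ) with ht
  have hs0 : 0 < s := by positivity
  have ht0 : 0 < t := by positivity
  have hst : s + t = 1 := by rw [hs, ht]; field_simp; ring
  have hγβ : γ * s + β * t = 1 := by rw [hs, ht]; field_simp; ring
  -- Hölder with exponents `1 / s` and `1 / t`, applied to `i * p i = (i ^ γ * p i) ^ s * (i ^ β * p
  -- i) ^ t`.
  have hconj : (s⁻¹).HolderConjugate t⁻¹ := by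
    rw [Real.holderConjugate_iff]
    refine ⟨(one_lt_inv₀ hs0).mpr (by linarith), by simpa using hst⟩
  have e : ∀ (v r : ℝ), 0 < r → 0 ≤ v → (v ^ r) ^ r⁻¹ = v := fun v r hr hv => by
    rw [← Real.rpow_mul hv, mul_inv_cancel₀ hr.ne', Real.rpow_one]
  have n1 : ∀ i : ℕ+, 0 ≤ ((i : ℕ) : ℝ) ^ γ * p i := fun i => mul_nonneg (by positivity) (hp i)
  have n2 : ∀ i : ℕ+, 0 ≤ ((i : ℕ) : ℝ) ^ β * p i := fun i => mul_nonneg (by positivity) (hp i)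
  have := Real.summable_and_inner_le_Lp_mul_Lq_tsum_of_nonneg hconj
    (f := fun i : ℕ+ => (((i : ℕ) : ℝ) ^ γ * p i) ^ s)
    (g := fun i : ℕ+ => (((i : ℕ) : ℝ) ^ β * p i) ^ t)
    (fun i => Real.rpow_nonneg (n1 i) _) (fun i => Real.rpow_nonneg (n2 i) _)
    (by simpa only [e _ _ hs0 (n1 _)] using hγs) (by simpa only [e _ _ ht0 (n2 _)] using hβs)
  have := this.2
  simp only [e _ _ hs0 (n1 _), e _ _ ht0 (n2 _), one_div, inv_inv] at this
  refine le_trans (le_of_eq (tsum_congr fun i => ?_)) this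
  have hi := cast_pos i
  rw [Real.mul_rpow (by positivity) (hp i), Real.mul_rpow (by positivity) (hp i),
    ← Real.rpow_mul hi.le, ← Real.rpow_mul hi.le]
  calc ((i : ℕ) : ℝ) * p i
      = ((i : ℕ) : ℝ) ^ (γ * s + β * t) * p i ^ (s + t) := by
        rw [hγβ, hst, Real.rpow_one, Real.rpow_one]
    _ = _ := by rw [Real.rpow_add hi, Real.rpow_add' (hp i) (by rw [hst]; norm_num)]; ring

end Preliminaries

/-! ### Detailed balance coefficients and equilibria -/

/-- Two-sided bounds for the successive ratios of the detailed balance coefficients. -/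
structure RatioBounds (Q : ℕ+ → ℝ) (zs q : ℝ) : Prop where
  zs_pos : 0 < zs
  q_pos : 0 < q
  pos : ∀ i, 0 < Q i
  upper : ∀ i, zs * Q (i + 1) ≤ Q i
  lower : ∀ i, q * Q i ≤ zs * Q (i + 1)

/-- Monotonicity of `α` gives the upper bound. The ratios `α i / α (i + 1)` converge, hence are
bounded, which gives the lower one. -/
lemma HasTypicalForm.exists_ratioBounds {Q α : ℕ+ → ℝ} {zs : ℝ} (hQ : HasTypicalForm Q α zs)
    (hzs : 0 < zs) : ∃ q, RatioBounds Q zs q := by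
  have ht : Tendsto (fun i : ℕ+ => α i / α (i + 1)) atTop (𝓝 1) := by
    simpa [inv_div] using hQ.tendsto_ratio.inv₀ one_ne_zero
  have hsucc : Tendsto Nat.succPNat atTop atTop :=
    tendsto_atTop_atTop.2 fun b => ⟨b, fun n hn => by
      rw [← PNat.coe_le_coe, Nat.succPNat_coe]; omega⟩
  obtain ⟨B, hB⟩ := (ht.comp hsucc).bddAbove_range
  have hB' : ∀ i : ℕ+, α i / α (i + 1) ≤ B := fun i => by
    have := hB ⟨i.natPred, rfl⟩
    simpa using this
  have hB0 : 0 < B := (div_pos (hQ.pos 1) (hQ.pos _)).trans_le (hB' 1)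
  have hsQ : ∀ i : ℕ+, zs * Q (i + 1) = zs ^ (1 - ((i : ℕ) : ℤ)) * α (i + 1) := fun i => by
    rw [hQ.eq, ← mul_assoc, ← zpow_one_add₀ hzs.ne']
    congr 2
    push_cast; ring
  refine ⟨B⁻¹, hzs, by positivity, fun i => ?_, fun i => ?_, fun i => ?_⟩
  · rw [hQ.eq]; exact mul_pos (zpow_pos hzs _) (hQ.pos i)
  · rw [hsQ, hQ.eq]
    exact mul_le_mul_of_nonneg_left (hQ.antitone (PNat.lt_add_right i 1).le) (zpow_pos hzs _).le
  · rw [hsQ, hQ.eq, mul_left_comm]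
    refine mul_le_mul_of_nonneg_left ?_ (zpow_pos hzs _).le
    rw [inv_mul_le_iff₀ hB0]
    exact (div_le_iff₀ (hQ.pos _)).mp (hB' i)

namespace RatioBounds

variable {Q : ℕ+ → ℝ} {zs q : ℝ}

lemma mul_pow_le (h : RatioBounds Q zs q) (i : ℕ+) : Q i * zs ^ (i : ℕ) ≤ Q 1 * zs := by
  induction i using PNat.recOn with
  | one => simp
  | succ i ih =>
    refine le_trans ?_ ih
    have := mul_le_mul_of_nonneg_right (h.upper i) (pow_pos h.zs_pos (i : ℕ)).le
    rw [PNat.add_coe, PNat.one_coe, pow_succ]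
    linarith

lemma le_mul_pow (h : RatioBounds Q zs q) (i : ℕ+) :
    Q 1 * zs * q ^ (i : ℕ) ≤ Q i * zs ^ (i : ℕ) := by
  have hq1 : q ≤ 1 := by
    have := (h.lower 1).trans (h.upper 1)
    nlinarith [h.pos 1]
  induction i using PNat.recOn with
  | one =>
    have := mul_pos (h.pos 1) h.zs_pos
    simp only [PNat.one_coe, pow_one]
    nlinarith
  | succ i ih =>
    have h1 := mul_le_mul_of_nonneg_right (h.lower i) (pow_pos h.zs_pos (i : ℕ)).le
    have h2 := mul_le_mul_of_nonneg_right ih h.q_pos.le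
    rw [PNat.add_coe, PNat.one_coe, pow_succ, pow_succ]
    linarith

lemma mul_pow_le_geometric (h : RatioBounds Q zs q) {z : ℝ} (hz : 0 ≤ z) (i : ℕ+) :
    Q i * z ^ (i : ℕ) ≤ Q 1 * zs * (z / zs) ^ (i : ℕ) := by
  have h1 := mul_le_mul_of_nonneg_right (h.mul_pow_le i)
    (pow_nonneg (div_nonneg hz h.zs_pos.le) (i : ℕ))
  rwa [mul_assoc (Q i), ← mul_pow, mul_div_cancel₀ _ h.zs_pos.ne'] at h1

lemma summable_rpow (h : RatioBounds Q zs q) {z : ℝ} (hz : 0 ≤ z) (hzs : z < zs) (β : ℝ) :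
    Summable fun i : ℕ+ => ((i : ℕ) : ℝ) ^ β * (Q i * z ^ (i : ℕ)) := by
  have hzz : 0 ≤ z / zs := div_nonneg hz h.zs_pos.le
  have hzz1 : z / zs < 1 := (div_lt_one h.zs_pos).mpr hzs
  refine Summable.of_nonneg_of_le (fun i => ?_) (fun i => ?_)
    ((summable_pow_mul_geometric_pnat ⌈β⌉₊ hzz hzz1).mul_left (Q 1 * zs))
  · have := h.pos i
    positivity
  · have h1 : ((i : ℕ) : ℝ) ^ β ≤ ((i : ℕ) : ℝ) ^ ⌈β⌉₊ := by
      rw [← Real.rpow_natCast]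
      exact Real.rpow_le_rpow_of_exponent_le (one_le_cast i) (Nat.le_ceil β)
    have h2 := h.mul_pow_le_geometric hz i
    calc ((i : ℕ) : ℝ) ^ β * (Q i * z ^ (i : ℕ))
        ≤ ((i : ℕ) : ℝ) ^ ⌈β⌉₊ * (Q 1 * zs * (z / zs) ^ (i : ℕ)) :=
          mul_le_mul h1 h2 (by have := h.pos i; positivity) (by positivity)
      _ = _ := by ring

lemma summable_mass (h : RatioBounds Q zs q) {z : ℝ} (hz : 0 ≤ z) (hzs : z < zs) :
    Summable fun i : ℕ+ => ((i : ℕ) : ℝ) * (Q i * z ^ (i : ℕ)) := by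
  simpa using h.summable_rpow hz hzs 1

lemma summable_equilibrium (h : RatioBounds Q zs q) {z : ℝ} (hz : 0 ≤ z) (hzs : z < zs) :
    Summable fun i : ℕ+ => z ^ (i : ℕ) * Q i := by
  simpa [mul_comm] using h.summable_rpow hz hzs 0

lemma exists_isEquilibriumDensity (h : RatioBounds Q zs q) {z : ℝ} (hz : 0 ≤ z) (hzs : z < zs) :
    ∃ ϱ, IsEquilibriumDensity Q ϱ z :=
  ⟨_, hz, by simpa only [mul_assoc] using (h.summable_mass hz hzs).hasSum⟩

lemma mass_strictMono (h : RatioBounds Q zs q) {ϱ ϱ' z z' : ℝ} (hz : IsEquilibriumDensity Q ϱ z)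
    (hz' : IsEquilibriumDensity Q ϱ' z') (hlt : z < z') : ϱ < ϱ' := by
  have hz0 := hz.nonneg
  refine hasSum_lt (i := 1) (fun i => ?_) ?_ hz.mass hz'.mass
  · have := h.pos i
    gcongr
  · have := h.pos 1
    simpa using mul_lt_mul_of_pos_left hlt this

/-- A finite partial sum already exceeds `ϱ` at `zs`; it is a polynomial, so it still does slightly
below `zs`. This covers finite and infinite critical mass alike. -/
lemma exists_partial_mass (h : RatioBounds Q zs q) {ϱ : ℝ} (hϱ0 : 0 ≤ ϱ)
    (hϱ : ENNReal.ofReal ϱ < equilibriumMass Q (ENNReal.ofReal zs)) :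
    ∃ z, 0 < z ∧ z < zs ∧ ∃ s : Finset ℕ+, ϱ < ∑ i ∈ s, ((i : ℕ) : ℝ) * Q i * z ^ (i : ℕ) := by
  rw [equilibriumMass, ENNReal.tsum_eq_iSup_sum, lt_iSup_iff] at hϱ
  obtain ⟨s, hs⟩ := hϱ
  have e : ∑ i ∈ s, ((i : ℕ) : ℝ≥0∞) * ENNReal.ofReal (Q i) * ENNReal.ofReal zs ^ (i : ℕ) =
      ENNReal.ofReal (∑ i ∈ s, ((i : ℕ) : ℝ) * Q i * zs ^ (i : ℕ)) := by
    have hzs := h.zs_pos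
    rw [ENNReal.ofReal_sum_of_nonneg fun i _ => by have := h.pos i; positivity]
    refine Finset.sum_congr rfl fun i _ => ?_
    have := h.pos i
    rw [ENNReal.ofReal_mul (by positivity), ENNReal.ofReal_mul (by positivity),
      ENNReal.ofReal_pow hzs.le, ENNReal.ofReal_natCast]
  rw [e, ENNReal.ofReal_lt_ofReal_iff_of_nonneg hϱ0] at hs
  have hc : Continuous fun z : ℝ => ∑ i ∈ s, ((i : ℕ) : ℝ) * Q i * z ^ (i : ℕ) := by fun_prop
  have h1 : ∀ᶠ z in 𝓝[<] zs, ϱ < ∑ i ∈ s, ((i : ℕ) : ℝ) * Q i * z ^ (i : ℕ) :=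
    (hc.continuousAt.eventually (lt_mem_nhds hs)).filter_mono nhdsWithin_le_nhds
  have h2 : ∀ᶠ z in 𝓝[<] zs, 0 < z :=
    (lt_mem_nhds h.zs_pos).filter_mono nhdsWithin_le_nhds
  obtain ⟨z, hz, hz0, hzs⟩ := (h1.and (h2.and self_mem_nhdsWithin)).exists
  exact ⟨z, hz0, hzs, s, hz⟩

lemma exists_equilibrium (h : RatioBounds Q zs q) {ϱ : ℝ} (hϱ0 : 0 < ϱ)
    (hϱ : ENNReal.ofReal ϱ < equilibriumMass Q (ENNReal.ofReal zs)) :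
    ∃ z, 0 < z ∧ z < zs ∧ IsEquilibriumDensity Q ϱ z := by
  obtain ⟨y, hy0, hys, s, hs⟩ := h.exists_partial_mass hϱ0.le hϱ
  have hsum := h.summable_mass hy0.le hys
  set F : ℝ → ℝ := fun z => ∑' i : ℕ+, ((i : ℕ) : ℝ) * (Q i * z ^ (i : ℕ)) with hF
  have hcont : ContinuousOn F (Set.Icc 0 y) := by
    refine continuousOn_tsum (fun i => by fun_prop) hsum fun i z hz => ?_
    have h0 := h.pos i
    have := hz.1
    rw [Real.norm_of_nonneg (by positivity)]
    have := hz.2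
    gcongr
  have hF0 : F 0 = 0 := by simp [hF]
  have hFy : ϱ ≤ F y := by
    refine hs.le.trans ?_
    simp only [mul_assoc]
    exact hsum.sum_le_tsum s fun i _ => by have := h.pos i; positivity
  obtain ⟨z, hz, hzϱ⟩ := intermediate_value_Icc hy0.le hcont ⟨hF0.trans_le hϱ0.le, hFy⟩
  refine ⟨z, lt_of_le_of_ne hz.1 ?_, hz.2.trans_lt hys, hz.1, ?_⟩
  · rintro rfl
    linarith
  · have := (h.summable_mass hz.1 (hz.2.trans_lt hys)).hasSum
    rw [← hzϱ]
    simpa only [mul_assoc] using this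

lemma isEquilibriumDensity_unique (h : RatioBounds Q zs q) {ϱ z z' : ℝ}
    (hz : IsEquilibriumDensity Q ϱ z) (hz' : IsEquilibriumDensity Q ϱ z') : z = z' := by
  rcases lt_trichotomy z z' with hlt | heq | hlt
  · exact absurd (h.mass_strictMono hz hz' hlt) (lt_irrefl _)
  · exact heq
  · exact absurd (h.mass_strictMono hz' hz hlt) (lt_irrefl _)

/-- The logarithm of a bounded density relative to the equilibrium grows at most linearly. -/
lemma exists_log_le (h : RatioBounds Q zs q) {ϱ δ : ℝ} (hϱ : 0 < ϱ) (hδ : 0 < δ) :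
    ∃ L, 0 < L ∧ ∀ z x : ℝ, δ ≤ z → 0 < x → x ≤ ϱ → ∀ i : ℕ+,
      4 + max 0 (Real.log (x / (z ^ (i : ℕ) * Q i))) ≤ L * ((i : ℕ) : ℝ) := by
  have hzs := h.zs_pos
  have hq := h.q_pos
  have hQ1 := h.pos 1
  refine ⟨4 + |Real.log (ϱ / (Q 1 * zs))| + |Real.log (zs / (q * δ))|, by positivity,
    fun z x hz hx hxϱ i => ?_⟩
  have hQi := h.pos i
  have hz0 := hδ.trans_le hz
  have hi := one_le_cast i
  -- A geometric lower bound for the equilibrium makes the logarithm at most affine in `i`; the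
  -- constant terms are absorbed using `1 ≤ i`.
  have h1 : Q 1 * zs * (q * δ / zs) ^ (i : ℕ) ≤ z ^ (i : ℕ) * Q i := by
    calc Q 1 * zs * (q * δ / zs) ^ (i : ℕ) = Q 1 * zs * q ^ (i : ℕ) * (δ / zs) ^ (i : ℕ) := by
          rw [mul_div_assoc, mul_pow]; ring
      _ ≤ Q i * zs ^ (i : ℕ) * (δ / zs) ^ (i : ℕ) := by
          have := h.le_mul_pow i
          gcongr
      _ = δ ^ (i : ℕ) * Q i := by
          rw [mul_assoc, ← mul_pow, mul_div_cancel₀ _ hzs.ne', mul_comm]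
      _ ≤ _ := by gcongr
  have h2 : x / (z ^ (i : ℕ) * Q i) ≤ ϱ / (Q 1 * zs) * (zs / (q * δ)) ^ (i : ℕ) := by
    calc x / (z ^ (i : ℕ) * Q i) ≤ ϱ / (Q 1 * zs * (q * δ / zs) ^ (i : ℕ)) := by gcongr
      _ = _ := by rw [← inv_div (q * δ) zs, inv_pow]; field_simp
  have h3 := Real.log_le_log (by positivity) h2
  rw [Real.log_mul (by positivity) (by positivity), Real.log_pow] at h3
  have h4 := le_abs_self (Real.log (ϱ / (Q 1 * zs)))
  have h5 := mul_le_mul_of_nonneg_left (le_abs_self (Real.log (zs / (q * δ)))) (cast_pos i).le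
  have h6 := le_mul_of_one_le_right (abs_nonneg (Real.log (ϱ / (Q 1 * zs)))) hi
  have h7 : 0 ≤ |Real.log (zs / (q * δ))| * ((i : ℕ) : ℝ) := by positivity
  have h8 : max 0 (Real.log (x / (z ^ (i : ℕ) * Q i))) ≤
      |Real.log (ϱ / (Q 1 * zs))| * ((i : ℕ) : ℝ) + |Real.log (zs / (q * δ))| * ((i : ℕ) : ℝ) :=
    max_le (by positivity) (by linarith)
  linarith

end RatioBounds

/-! ### Relative free energy and Hellinger distance -/

section FreeEnergy

variable {Q c : ℕ+ → ℝ} {zs q ϱ : ℝ}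

lemma IsPositiveWithMass.le_mass (hc : IsPositiveWithMass c ϱ) (i : ℕ+) : c i ≤ ϱ := by
  have h0 := hc.pos i
  have h1 := le_hasSum hc.mass i fun j _ => by have := hc.pos j; positivity
  have h2 := one_le_cast i
  nlinarith

lemma freeEnergyTerm_add_nonneg (h : RatioBounds Q zs q) (hc : ∀ i, 0 < c i) {z : ℝ} (hz : 0 < z)
    (i : ℕ+) : 0 ≤ freeEnergyTerm Q z c i + z ^ (i : ℕ) * Q i :=
  relativeEntropy_nonneg (hc i) (mul_pos (pow_pos hz _) (h.pos i))

/-- The relative free energy density is controlled by the squared Hellinger distance, with one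
additional moment. -/
lemma exists_freeEnergyTerm_add_le (h : RatioBounds Q zs q) {δ : ℝ} (hϱ : 0 < ϱ) (hδ : 0 < δ) :
    ∃ L, 0 < L ∧ ∀ z, δ ≤ z → ∀ c, IsPositiveWithMass c ϱ → ∀ i : ℕ+,
      freeEnergyTerm Q z c i + z ^ (i : ℕ) * Q i ≤
        L * (((i : ℕ) : ℝ) * (√(c i) - √(z ^ (i : ℕ) * Q i)) ^ 2) := by
  obtain ⟨L, hL, hLe⟩ := h.exists_log_le hϱ hδ
  refine ⟨L, hL, fun z hz c hc i => ?_⟩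
  have hz0 := hδ.trans_le hz
  refine (relativeEntropy_le (hc.pos i) (mul_pos (pow_pos hz0 _) (h.pos i))).trans ?_
  rw [← mul_assoc]
  exact mul_le_mul_of_nonneg_right (hLe z (c i) hz (hc.pos i) (hc.le_mass i) i) (sq_nonneg _)

lemma summable_rpow_hellinger (h : RatioBounds Q zs q) (hc : ∀ i, 0 < c i) {z β : ℝ} (hz : 0 < z)
    (hzs : z < zs) (hs : Summable fun i : ℕ+ => ((i : ℕ) : ℝ) ^ β * c i) :
    (Summable fun i : ℕ+ => ((i : ℕ) : ℝ) ^ β * (√(c i) - √(z ^ (i : ℕ) * Q i)) ^ 2) ∧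
    ∑' i : ℕ+, ((i : ℕ) : ℝ) ^ β * (√(c i) - √(z ^ (i : ℕ) * Q i)) ^ 2 ≤
      ∑' i : ℕ+, ((i : ℕ) : ℝ) ^ β * c i +
      ∑' i : ℕ+, ((i : ℕ) : ℝ) ^ β * (Q i * z ^ (i : ℕ)) := by
  have hle : ∀ i : ℕ+, ((i : ℕ) : ℝ) ^ β * (√(c i) - √(z ^ (i : ℕ) * Q i)) ^ 2 ≤
      ((i : ℕ) : ℝ) ^ β * c i + ((i : ℕ) : ℝ) ^ β * (Q i * z ^ (i : ℕ)) := fun i => by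
    rw [← mul_add, mul_comm (Q i)]
    have := h.pos i
    exact mul_le_mul_of_nonneg_left (sq_sqrt_sub_sqrt_le (hc i).le (by positivity)) (by positivity)
  have hs' := hs.add (h.summable_rpow hz.le hzs β)
  have hsum := Summable.of_nonneg_of_le (fun i => by positivity) hle hs'
  exact ⟨hsum, (hsum.tsum_le_tsum hle hs').trans_eq
    (hs.tsum_add (h.summable_rpow hz.le hzs β))⟩

lemma summable_hellinger (h : RatioBounds Q zs q) (hc : IsPositiveWithMass c ϱ) {z : ℝ}
    (hz : 0 < z) (hzs : z < zs) :
    Summable fun i : ℕ+ => ((i : ℕ) : ℝ) * (√(c i) - √(z ^ (i : ℕ) * Q i)) ^ 2 := by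
  simpa using (summable_rpow_hellinger (β := 1) h hc.pos hz hzs
    (by simpa using hc.mass.summable)).1

lemma summable_freeEnergyTerm_add (h : RatioBounds Q zs q) (hϱ : 0 < ϱ)
    (hc : IsPositiveWithMass c ϱ) {z : ℝ} (hz : 0 < z) (hzs : z < zs) :
    Summable fun i : ℕ+ => freeEnergyTerm Q z c i + z ^ (i : ℕ) * Q i := by
  obtain ⟨L, -, hL⟩ := exists_freeEnergyTerm_add_le h hϱ hz
  exact Summable.of_nonneg_of_le (freeEnergyTerm_add_nonneg h hc.pos hz) (hL z le_rfl c hc)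
    ((summable_hellinger h hc hz hzs).mul_left L)

lemma summable_freeEnergyTerm (h : RatioBounds Q zs q) (hϱ : 0 < ϱ)
    (hc : IsPositiveWithMass c ϱ) {z : ℝ} (hz : 0 < z) (hzs : z < zs) :
    Summable (freeEnergyTerm Q z c) := by
  simpa using (summable_freeEnergyTerm_add h hϱ hc hz hzs).sub (h.summable_equilibrium hz.le hzs)

lemma relativeFreeEnergy_eq_tsum (h : RatioBounds Q zs q) (hϱ : 0 < ϱ)
    (hc : IsPositiveWithMass c ϱ) {z : ℝ} (hz : 0 < z) (hzs : z < zs) :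
    relativeFreeEnergy Q z c = ∑' i : ℕ+, (freeEnergyTerm Q z c i + z ^ (i : ℕ) * Q i) :=
  ((summable_freeEnergyTerm h hϱ hc hz hzs).tsum_add (h.summable_equilibrium hz.le hzs)).symm

lemma relativeFreeEnergy_nonneg (h : RatioBounds Q zs q) (hϱ : 0 < ϱ)
    (hc : IsPositiveWithMass c ϱ) {z : ℝ} (hz : 0 < z) (hzs : z < zs) :
    0 ≤ relativeFreeEnergy Q z c := by
  rw [relativeFreeEnergy_eq_tsum h hϱ hc hz hzs]
  exact tsum_nonneg (freeEnergyTerm_add_nonneg h hc.pos hz)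

/-- Among all equilibria, the one with the mass of `c` minimizes the relative free energy. -/
lemma relativeFreeEnergy_le (h : RatioBounds Q zs q) (hϱ : 0 < ϱ)
    (hc : IsPositiveWithMass c ϱ) {zbar z : ℝ} (hzb : IsEquilibriumDensity Q ϱ zbar)
    (hzb0 : 0 < zbar) (hzbs : zbar < zs) (hz : 0 < z) (hzs : z < zs) :
    relativeFreeEnergy Q zbar c ≤ relativeFreeEnergy Q z c := by
  have h1 := (summable_freeEnergyTerm_add h hϱ hc hzb0 hzbs).hasSum
  have h2 := (summable_freeEnergyTerm_add h hϱ hc hz hzs).hasSum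
  -- Both masses equal `ϱ`, so this series sums to zero; adding it makes the comparison hold term by
  -- term.
  have h3 := (hc.mass.sub hzb.mass).mul_right (Real.log z - Real.log zbar)
  rw [← relativeFreeEnergy_eq_tsum h hϱ hc hzb0 hzbs] at h1
  rw [← relativeFreeEnergy_eq_tsum h hϱ hc hz hzs] at h2
  rw [sub_self, zero_mul] at h3
  have h4 := h2.add h3
  rw [add_zero] at h4
  refine hasSum_le (fun i => ?_) h1 h4
  have hci := hc.pos i
  have hQi := h.pos i
  have l : ∀ w : ℝ, 0 < w → Real.log (c i / (w ^ (i : ℕ) * Q i)) =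
      Real.log (c i) - ((i : ℕ) : ℝ) * Real.log w - Real.log (Q i) := fun w hw => by
    rw [Real.log_div hci.ne' (by positivity), Real.log_mul (by positivity) hQi.ne', Real.log_pow]
    ring
  have key : ((i : ℕ) : ℝ) * (Real.log z - Real.log zbar) ≤ (z / zbar) ^ (i : ℕ) - 1 := by
    rw [← Real.log_div hz.ne' hzb0.ne', ← Real.log_pow]
    exact Real.log_le_sub_one_of_pos (by positivity)
  have key2 := mul_le_mul_of_nonneg_left key (show 0 ≤ Q i * zbar ^ (i : ℕ) by positivity)
  have e : Q i * zbar ^ (i : ℕ) * ((z / zbar) ^ (i : ℕ) - 1) =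
      Q i * z ^ (i : ℕ) - Q i * zbar ^ (i : ℕ) := by
    rw [div_pow]; field_simp
  rw [e] at key2
  simp only [freeEnergyTerm, l z hz, l zbar hzb0]
  linarith

end FreeEnergy

/-! ### Dissipation estimates for moderate monomer density -/

/-- The difference whose square enters the lower dissipation. -/
noncomputable def rootFlux (Q c : ℕ+ → ℝ) (i : ℕ+) : ℝ :=
  √(c 1 * c i / Q i) - √(c (i + 1) / Q (i + 1))

section Dissipation

variable {Q c a b : ℕ+ → ℝ} {zs q ϱ γ C₁ : ℝ}

lemma sqrt_succ_eq (hc : ∀ i, 0 < c i) (i : ℕ+) :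
    √(c (i + 1) / Q (i + 1)) = √(c 1) * √(c i / Q i) - rootFlux Q c i := by
  rw [rootFlux, mul_div_assoc, Real.sqrt_mul (hc 1).le]; ring

lemma mul_sq_sqrt_div {x y : ℝ} (hx : 0 ≤ x) (hy : 0 < y) : y * √(x / y) ^ 2 = x := by
  rw [Real.sq_sqrt (by positivity)]; field_simp

lemma sqrt_pow_nat {x : ℝ} (hx : 0 ≤ x) (n : ℕ) : √(x ^ n) = √x ^ n := by
  rw [Real.sqrt_eq_iff_mul_self_eq (by positivity) (by positivity), ← mul_pow,
    Real.mul_self_sqrt hx]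

/-- The upper bound on `a` serves only here, and only qualitatively, so no later constant depends on
`C₂`. -/
lemma summable_lowerDissipationTerm (h : RatioBounds Q zs q) (hγ : γ ≤ 1)
    (hab : IsAdmissible Q γ C₁ a b) (hc : IsPositiveWithMass c ϱ) :
    Summable (lowerDissipationTerm a Q c) := by
  obtain ⟨C₂, hC₂, hup⟩ := hab.upper
  have hzs := h.zs_pos
  have hq := h.q_pos
  refine Summable.of_nonneg_of_le (fun i => ?_) (fun i => ?_)
    ((hc.mass.summable.mul_left (C₂ * (2 * c 1))).add
      ((hasSum_pnat_shift hc.mass).summable.mul_left (C₂ * (2 * (zs / q)))))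
  · have := hab.coag_pos i
    have := h.pos i
    rw [lowerDissipationTerm]; positivity
  · have hQi := h.pos i
    have hQs := h.pos (i + 1)
    have hci := hc.pos i
    have hcs := hc.pos (i + 1)
    have hc1 := hc.pos 1
    have hi := one_le_cast i
    have hai : a i ≤ C₂ * ((i : ℕ) : ℝ) := (hup i).trans (by
      gcongr
      exact (Real.rpow_le_rpow_of_exponent_le hi hγ).trans_eq (Real.rpow_one _))
    have h1 : (√(c 1 * c i / Q i) - √(c (i + 1) / Q (i + 1))) ^ 2 ≤
        2 * (c 1 * c i / Q i + c (i + 1) / Q (i + 1)) :=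
      (sq_sqrt_sub_sqrt_le (by positivity) (by positivity)).trans
        (le_mul_of_one_le_left (by positivity) one_le_two)
    have h2 : Q i * (c (i + 1) / Q (i + 1)) ≤ zs / q * c (i + 1) := by
      have : Q i / Q (i + 1) ≤ zs / q := by
        rw [div_le_div_iff₀ hQs hq]
        linarith [h.lower i]
      calc Q i * (c (i + 1) / Q (i + 1)) = Q i / Q (i + 1) * c (i + 1) := by ring
        _ ≤ _ := by gcongr
    calc lowerDissipationTerm a Q c i
        ≤ a i * (Q i * (2 * (c 1 * c i / Q i + c (i + 1) / Q (i + 1)))) := by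
          rw [lowerDissipationTerm, mul_assoc]
          have := hab.coag_pos i
          gcongr
      _ = a i * (2 * (c 1 * c i + Q i * (c (i + 1) / Q (i + 1)))) := by field_simp
      _ ≤ C₂ * ((i : ℕ) : ℝ) * (2 * (c 1 * c i + zs / q * c (i + 1))) := by
          have := hab.coag_pos i
          gcongr
      _ ≤ C₂ * (2 * c 1) * (((i : ℕ) : ℝ) * c i) +
          C₂ * (2 * (zs / q)) * ((((i + 1 : ℕ+) : ℕ) : ℝ) * c (i + 1)) := by
          rw [cast_succ]
          have : 0 ≤ C₂ * (2 * (zs / q)) * c (i + 1) := by positivity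
          linarith

lemma lowerDissipationTerm_nonneg (h : RatioBounds Q zs q) (hab : IsAdmissible Q γ C₁ a b)
    (i : ℕ+) : 0 ≤ lowerDissipationTerm a Q c i := by
  have := hab.coag_pos i
  have := h.pos i
  rw [lowerDissipationTerm]; positivity

lemma lowerDissipation_nonneg (h : RatioBounds Q zs q) (hab : IsAdmissible Q γ C₁ a b) :
    0 ≤ lowerDissipation a Q c :=
  tsum_nonneg (lowerDissipationTerm_nonneg h hab)

lemma mul_rpow_rootFlux_le (h : RatioBounds Q zs q) (hab : IsAdmissible Q γ C₁ a b) (i : ℕ+) :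
    C₁ * (((i : ℕ) : ℝ) ^ γ * (Q i * rootFlux Q c i ^ 2)) ≤ lowerDissipationTerm a Q c i := by
  have := h.pos i
  calc C₁ * (((i : ℕ) : ℝ) ^ γ * (Q i * rootFlux Q c i ^ 2))
      = C₁ * ((i : ℕ) : ℝ) ^ γ * (Q i * rootFlux Q c i ^ 2) := by ring
    _ ≤ a i * (Q i * rootFlux Q c i ^ 2) := by
      have := hab.lower i
      gcongr
    _ = _ := by rw [lowerDissipationTerm, rootFlux]; ring

lemma summable_rootFlux (h : RatioBounds Q zs q) (hγ : γ ≤ 1) (hC₁ : 0 < C₁)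
    (hab : IsAdmissible Q γ C₁ a b) (hc : IsPositiveWithMass c ϱ) :
    (Summable fun i : ℕ+ => ((i : ℕ) : ℝ) ^ γ * (Q i * rootFlux Q c i ^ 2)) ∧
    ∑' i : ℕ+, ((i : ℕ) : ℝ) ^ γ * (Q i * rootFlux Q c i ^ 2) ≤ lowerDissipation a Q c / C₁ := by
  have hs := summable_lowerDissipationTerm h hγ hab hc
  have hle : ∀ i : ℕ+, ((i : ℕ) : ℝ) ^ γ * (Q i * rootFlux Q c i ^ 2) ≤
      lowerDissipationTerm a Q c i / C₁ := fun i => by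
    rw [le_div_iff₀ hC₁, mul_comm]
    exact mul_rpow_rootFlux_le h hab i
  have hsum := Summable.of_nonneg_of_le
    (fun i => by have := h.pos i; positivity) hle (hs.div_const C₁)
  exact ⟨hsum, (hsum.tsum_le_tsum hle (hs.div_const C₁)).trans_eq (tsum_div_const ..)⟩

lemma abs_rootFlux_le (h : RatioBounds Q zs q) (hγ : γ ≤ 1) (hC₁ : 0 < C₁)
    (hab : IsAdmissible Q γ C₁ a b) (hc : IsPositiveWithMass c ϱ) (i : ℕ+) :
    |rootFlux Q c i| ≤ √(lowerDissipation a Q c) / √(C₁ * ((i : ℕ) : ℝ) ^ γ * Q i) := by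
  have hQi := h.pos i
  have hi := Real.rpow_pos_of_pos (cast_pos i) γ
  rw [← Real.sqrt_div (lowerDissipation_nonneg h hab)]
  refine Real.abs_le_sqrt ?_
  rw [le_div_iff₀ (by positivity)]
  have := (summable_lowerDissipationTerm h hγ hab hc).le_tsum i
    fun j _ => lowerDissipationTerm_nonneg h hab j
  have h2 := mul_rpow_rootFlux_le (c := c) h hab i
  rw [lowerDissipation]
  linarith

/-- The squared Hellinger distance to the equilibrium with the same monomer density contracts, up
to the dissipation. -/
lemma hellinger_succ_le (h : RatioBounds Q zs q) (hc : ∀ i, 0 < c i) {ε θ : ℝ} (hε : 0 < ε)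
    (hθ : (1 + ε) * (c 1 / zs) ≤ θ) (i : ℕ+) :
    (√(c (i + 1)) - √(c 1 ^ ((i + 1 : ℕ+) : ℕ) * Q (i + 1))) ^ 2 ≤
      θ * (√(c i) - √(c 1 ^ (i : ℕ) * Q i)) ^ 2 +
      (1 + 1 / ε) / zs * (Q i * rootFlux Q c i ^ 2) := by
  have hzs := h.zs_pos
  have hc1 := hc 1
  have e : ∀ j : ℕ+, (√(c j) - √(c 1 ^ (j : ℕ) * Q j)) ^ 2 =
      Q j * (√(c j / Q j) - √(c 1) ^ (j : ℕ)) ^ 2 := fun j => by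
    have hQj := h.pos j
    have h1 : √(c j) = √(Q j) * √(c j / Q j) := by
      rw [← Real.sqrt_mul hQj.le, mul_div_cancel₀ _ hQj.ne']
    rw [h1, Real.sqrt_mul (by positivity), sqrt_pow_nat hc1.le]
    linear_combination (√(c j / Q j) - √(c 1) ^ (j : ℕ)) ^ 2 * Real.sq_sqrt hQj.le
  have hup : Q (i + 1) ≤ Q i / zs := by
    rw [le_div_iff₀ hzs, mul_comm]; exact h.upper i
  set v := √(c i / Q i) - √(c 1) ^ (i : ℕ) with hv
  -- The powers of `√(c 1)` solve the recursion without flux, so the deviation `v` obeys the same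
  -- recursion as `√(c i / Q i)`.
  have e2 : √(c (i + 1) / Q (i + 1)) - √(c 1) ^ ((i + 1 : ℕ+) : ℕ) =
      √(c 1) * v - rootFlux Q c i := by
    rw [sqrt_succ_eq hc, PNat.add_coe, PNat.one_coe, pow_succ]; ring
  have hQi := h.pos i
  rw [e, e, e2, ← hv]
  have hy := sub_sq_le_young (x := √(c 1) * v) (y := rootFlux Q c i) hε
  rw [mul_pow, Real.sq_sqrt hc1.le] at hy
  calc Q (i + 1) * (√(c 1) * v - rootFlux Q c i) ^ 2
      ≤ Q i / zs * ((1 + ε) * (c 1 * v ^ 2) + (1 + 1 / ε) * rootFlux Q c i ^ 2) := by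
        gcongr
    _ = (1 + ε) * (c 1 / zs) * (Q i * v ^ 2) +
        (1 + 1 / ε) / zs * (Q i * rootFlux Q c i ^ 2) := by ring
    _ ≤ _ := by gcongr

lemma summable_rpow_of_le_one (hγ : γ ≤ 1) {p : ℕ+ → ℝ} (hp : ∀ i, 0 ≤ p i)
    (hs : Summable fun i : ℕ+ => ((i : ℕ) : ℝ) * p i) :
    Summable fun i : ℕ+ => ((i : ℕ) : ℝ) ^ γ * p i :=
  Summable.of_nonneg_of_le (fun i => mul_nonneg (by positivity) (hp i))
    (fun i => mul_le_mul_of_nonneg_right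
      ((Real.rpow_le_rpow_of_exponent_le (one_le_cast i) hγ).trans_eq (Real.rpow_one _)) (hp i)) hs

lemma exists_hellinger_le_lowerDissipation (h : RatioBounds Q zs q) (hγ0 : 0 ≤ γ) (hγ1 : γ ≤ 1)
    {δ : ℝ} (hδ : 0 < δ) (hC₁ : 0 < C₁) :
    ∃ K, 0 < K ∧ ∀ a b : ℕ+ → ℝ, IsAdmissible Q γ C₁ a b →
      ∀ c, IsPositiveWithMass c ϱ → c 1 < zs - δ →
      ∑' i : ℕ+, ((i : ℕ) : ℝ) ^ γ * (√(c i) - √(c 1 ^ (i : ℕ) * Q i)) ^ 2 ≤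
        K * lowerDissipation a Q c := by
  have hzs := h.zs_pos
  -- With this `ε`, `c 1 / zs ≤ 1 - ε`, so the contraction factor is at most `(1 + ε) * (1 - ε) = 1
  -- - ε ^ 2`.
  obtain ⟨ε, hεd⟩ : ∃ ε, ε = δ / zs := ⟨_, rfl⟩
  have hε : 0 < ε := by rw [hεd]; positivity
  set A := 2 / (1 - (1 - ε ^ 2)) * (1 + 2 / (1 - (1 - ε ^ 2))) ^ 2 with hA
  have hA0 : 0 < A := by
    rw [hA, sub_sub_cancel]; positivity
  refine ⟨A * ((1 + 1 / ε) / zs) / C₁, by positivity, fun a b hab c hc hcδ => ?_⟩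
  have hc1 := hc.pos 1
  have hczs : c 1 / zs ≤ 1 - ε := by
    rw [div_le_iff₀ hzs, hεd, sub_mul, div_mul_cancel₀ _ hzs.ne']; linarith
  have hε1 : ε ≤ 1 := by
    have : 0 < c 1 / zs := by positivity
    linarith
  obtain ⟨hfs, hfle⟩ := summable_rootFlux h hγ1 hC₁ hab hc
  have hfs' : Summable fun i : ℕ+ =>
      ((i : ℕ) : ℝ) ^ γ * ((1 + 1 / ε) / zs * (Q i * rootFlux Q c i ^ 2)) := by
    simpa only [mul_left_comm] using hfs.mul_left ((1 + 1 / ε) / zs)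
  have := weighted_hardy (θ := 1 - ε ^ 2) hγ0 hγ1 (by nlinarith) (by nlinarith)
    (p := fun i : ℕ+ => (√(c i) - √(c 1 ^ (i : ℕ) * Q i)) ^ 2)
    (d := fun i => (1 + 1 / ε) / zs * (Q i * rootFlux Q c i ^ 2))
    (fun i => sq_nonneg _) (fun i => by have := h.pos i; positivity)
    (by simp [hab.detailedBalance.one])
    (hellinger_succ_le h hc.pos hε (by nlinarith))
    (summable_rpow_of_le_one hγ1 (fun i => sq_nonneg _) (summable_hellinger h hc hc1 (by linarith)))
    hfs'
  refine this.trans ?_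
  have e : ∑' i : ℕ+, ((i : ℕ) : ℝ) ^ γ * ((1 + 1 / ε) / zs * (Q i * rootFlux Q c i ^ 2)) =
      (1 + 1 / ε) / zs * ∑' i : ℕ+, ((i : ℕ) : ℝ) ^ γ * (Q i * rootFlux Q c i ^ 2) := by
    rw [← tsum_mul_left]
    exact tsum_congr fun i => by ring
  rw [e, ← hA]
  calc A * ((1 + 1 / ε) / zs * ∑' i : ℕ+, ((i : ℕ) : ℝ) ^ γ * (Q i * rootFlux Q c i ^ 2))
      ≤ A * ((1 + 1 / ε) / zs * (lowerDissipation a Q c / C₁)) := by gcongr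
    _ = _ := by ring

/-- The relative free energy is controlled by the first moment of the squared Hellinger distance
to the equilibrium with the same monomer density. -/
lemma exists_relativeFreeEnergy_le_hellinger (h : RatioBounds Q zs q) (hϱ : 0 < ϱ) {zbar δ : ℝ}
    (hzb : IsEquilibriumDensity Q ϱ zbar) (hzb0 : 0 < zbar) (hzbs : zbar < zs) (hδ : 0 < δ) :
    ∃ L, 0 < L ∧ ∀ c, IsPositiveWithMass c ϱ → δ < c 1 → c 1 < zs →
      relativeFreeEnergy Q zbar c ≤
        L * ∑' i : ℕ+, ((i : ℕ) : ℝ) * (√(c i) - √(c 1 ^ (i : ℕ) * Q i)) ^ 2 := by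
  obtain ⟨L, hL, hLe⟩ := exists_freeEnergyTerm_add_le h hϱ hδ
  refine ⟨L, hL, fun c hc hδc hcs => ?_⟩
  have hc1 := hc.pos 1
  refine (relativeFreeEnergy_le h hϱ hc hzb hzb0 hzbs hc1 hcs).trans ?_
  rw [relativeFreeEnergy_eq_tsum h hϱ hc hc1 hcs, ← tsum_mul_left]
  exact (summable_freeEnergyTerm_add h hϱ hc hc1 hcs).tsum_le_tsum (hLe _ hδc.le c hc)
    ((summable_hellinger h hc hc1 hcs).mul_left L)

theorem exists_linear_entropy_dissipation (h : RatioBounds Q zs q) (hϱ : 0 < ϱ) {zbar δ : ℝ}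
    (hzb : IsEquilibriumDensity Q ϱ zbar) (hzb0 : 0 < zbar) (hzbs : zbar < zs) (hδ : 0 < δ)
    (hC₁ : 0 < C₁) :
    ∃ K, 0 < K ∧ ∀ a b : ℕ+ → ℝ, IsAdmissible Q 1 C₁ a b →
      ∀ c, IsPositiveWithMass c ϱ → δ < c 1 → c 1 < zs - δ →
      K * relativeFreeEnergy Q zbar c ≤ lowerDissipation a Q c := by
  obtain ⟨L, hL, hLe⟩ := exists_relativeFreeEnergy_le_hellinger h hϱ hzb hzb0 hzbs hδ
  obtain ⟨K, hK, hKe⟩ :=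
    exists_hellinger_le_lowerDissipation (ϱ := ϱ) h zero_le_one le_rfl hδ hC₁
  refine ⟨(L * K)⁻¹, by positivity, fun a b hab c hc h1 h2 => ?_⟩
  have := hKe a b hab c hc h2
  simp only [Real.rpow_one] at this
  rw [inv_mul_le_iff₀ (by positivity), mul_assoc]
  exact (hLe c hc h1 (by linarith)).trans (by gcongr)

theorem exists_algebraic_entropy_dissipation (h : RatioBounds Q zs q) (hϱ : 0 < ϱ) {zbar δ β : ℝ}
    (M : ℝ) (hzb : IsEquilibriumDensity Q ϱ zbar) (hzb0 : 0 < zbar) (hzbs : zbar < zs)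
    (hδ : 0 < δ) (hC₁ : 0 < C₁) (hγ0 : 0 ≤ γ) (hγ1 : γ < 1) (hβ : 1 < β) :
    ∃ K, 0 < K ∧ ∀ a b : ℕ+ → ℝ, IsAdmissible Q γ C₁ a b →
      ∀ c, IsPositiveWithMass c ϱ → MomentLE c β M → δ < c 1 → c 1 < zs - δ →
      K * relativeFreeEnergy Q zbar c ^ ((β - γ) / (β - 1)) ≤ lowerDissipation a Q c := by
  obtain ⟨L, hL, hLe⟩ := exists_relativeFreeEnergy_le_hellinger h hϱ hzb hzb0 hzbs hδ
  obtain ⟨K, hK, hKe⟩ := exists_hellinger_le_lowerDissipation (ϱ := ϱ) h hγ0 hγ1.le hδ hC₁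
  -- `B` bounds the moment of order `β` of the squared Hellinger distance. It must be positive
  -- before any `c` is given, even if `M < 0` or `δ > zs`; hence `|M| + 1` and the `max`.
  obtain ⟨B, hB⟩ : ∃ B, B = |M| + 1 +
    ∑' i : ℕ+, ((i : ℕ) : ℝ) ^ β * (Q i * (max 0 (zs - δ)) ^ (i : ℕ)) := ⟨_, rfl⟩
  have hB0 : 0 < B := by
    have : 0 ≤ ∑' i : ℕ+, ((i : ℕ) : ℝ) ^ β * (Q i * (max 0 (zs - δ)) ^ (i : ℕ)) :=
      tsum_nonneg fun i => by have := h.pos i; positivity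
    rw [hB]; positivity
  have hβγ : 0 < β - γ := by linarith
  have hβ1 : 0 < β - 1 := by linarith
  set s := (β - 1) / (β - γ) with hs
  have hs0 : 0 < s := by positivity
  have hsi : (β - γ) / (β - 1) = s⁻¹ := by rw [hs, inv_div]
  rw [hsi]
  set T := L * B ^ ((1 - γ) / (β - γ)) with hT
  have hT0 : 0 < T := by positivity
  refine ⟨(T ^ s⁻¹ * K)⁻¹, by positivity, fun a b hab c hc hM h1 h2 => ?_⟩
  have hc1 := hc.pos 1
  have hczs : c 1 < zs := by linarith
  rw [inv_mul_le_iff₀ (by positivity)]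
  obtain ⟨hβs, hβle⟩ := summable_rpow_hellinger h hc.pos hc1 hczs hM.summable
  have hcmp : ∑' i : ℕ+, ((i : ℕ) : ℝ) ^ β * (Q i * c 1 ^ (i : ℕ)) ≤
      ∑' i : ℕ+, ((i : ℕ) : ℝ) ^ β * (Q i * (max 0 (zs - δ)) ^ (i : ℕ)) := by
    refine (h.summable_rpow hc1.le hczs β).tsum_le_tsum (fun i => ?_)
      (h.summable_rpow (le_max_left _ _) (max_lt h.zs_pos (by linarith)) β)
    have := h.pos i
    have := h2.le.trans (le_max_right 0 _)
    gcongr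
  have hβB : ∑' i : ℕ+, ((i : ℕ) : ℝ) ^ β * (√(c i) - √(c 1 ^ (i : ℕ) * Q i)) ^ 2 ≤ B := by
    have := hM.le
    have := le_abs_self M
    linarith
  have hD := lowerDissipation_nonneg (c := c) h hab
  have hH := relativeFreeEnergy_nonneg h hϱ hc hzb0 hzbs
  have key : relativeFreeEnergy Q zbar c ≤ T * (K * lowerDissipation a Q c) ^ s := by
    calc relativeFreeEnergy Q zbar c
        ≤ L * ∑' i : ℕ+, ((i : ℕ) : ℝ) * (√(c i) - √(c 1 ^ (i : ℕ) * Q i)) ^ 2 :=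
          hLe c hc h1 hczs
      _ ≤ L * ((K * lowerDissipation a Q c) ^ s * B ^ ((1 - γ) / (β - γ))) := by
          have n : ∀ r : ℝ, 0 ≤ ∑' i : ℕ+, ((i : ℕ) : ℝ) ^ r *
            (√(c i) - √(c 1 ^ (i : ℕ) * Q i)) ^ 2 := fun r => tsum_nonneg fun i => by positivity
          refine mul_le_mul_of_nonneg_left ((moment_interpolation hγ1 hβ (fun i => sq_nonneg _)
            (summable_rpow_of_le_one hγ1.le (fun i => sq_nonneg _)
              (summable_hellinger h hc hc1 hczs)) hβs).trans ?_) hL.le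
          refine mul_le_mul (Real.rpow_le_rpow (n _) (hKe a b hab c hc h2) hs0.le)
            (Real.rpow_le_rpow (n _) hβB (div_nonneg (by linarith) hβγ.le))
            (Real.rpow_nonneg (n _) _) (by positivity)
      _ = _ := by rw [hT]; ring
  calc relativeFreeEnergy Q zbar c ^ s⁻¹ ≤ (T * (K * lowerDissipation a Q c) ^ s) ^ s⁻¹ :=
        Real.rpow_le_rpow hH key (by positivity)
    _ = T ^ s⁻¹ * K * lowerDissipation a Q c := by
        rw [Real.mul_rpow hT0.le (by positivity), ← Real.rpow_mul (by positivity),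
          mul_inv_cancel₀ hs0.ne', Real.rpow_one, mul_assoc]

end Dissipation

/-! ### Dissipation bounds for extreme monomer density -/

section Extremes

variable {Q c a b : ℕ+ → ℝ} {zs q ϱ γ C₁ : ℝ}

/-- If the dissipation is small then each density is close to its equilibrium value. -/
lemma exists_root_bound (h : RatioBounds Q zs q) (hγ : γ ≤ 1) (hC₁ : 0 < C₁) (ϱ x : ℝ) (i : ℕ+) :
    ∃ E : ℝ, ∀ a b : ℕ+ → ℝ, IsAdmissible Q γ C₁ a b → ∀ c, IsPositiveWithMass c ϱ →
      (x ≤ c 1 → √x ^ (i : ℕ) - E * √(lowerDissipation a Q c) ≤ √(c i / Q i)) ∧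
      (c 1 ≤ x → √(c i / Q i) ≤ √x ^ (i : ℕ) + E * √(lowerDissipation a Q c)) := by
  induction i using PNat.recOn with
  | one =>
    refine ⟨0, fun a b hab c hc => ?_⟩
    simp only [hab.detailedBalance.one, PNat.one_coe, pow_one, zero_mul, sub_zero, add_zero, div_one]
    exact ⟨fun hx => Real.sqrt_le_sqrt hx, fun hx => Real.sqrt_le_sqrt hx⟩
  | succ i ih =>
    obtain ⟨E, hE⟩ := ih
    -- One step of the recursion multiplies the old error by `√x` and adds the bound on the flux.
    -- The constant depends on `i`, which is harmless since only finitely many indices are used.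
    refine ⟨√x * E + 1 / √(C₁ * ((i : ℕ) : ℝ) ^ γ * Q i), fun a b hab c hc => ?_⟩
    have hf := abs_le.mp (abs_rootFlux_le h hγ hC₁ hab hc i)
    obtain ⟨h1, h2⟩ := hE a b hab c hc
    rw [sqrt_succ_eq hc.pos, PNat.add_coe, PNat.one_coe, pow_succ, add_mul, one_div_mul_eq_div]
    have hu := Real.sqrt_nonneg (c i / Q i)
    have hx := Real.sqrt_nonneg x
    constructor <;> intro hxc <;> have hs := Real.sqrt_le_sqrt hxc
    · have := mul_le_mul_of_nonneg_left (h1 hxc) hx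
      have := mul_le_mul_of_nonneg_right hs hu
      linarith
    · have := mul_le_mul_of_nonneg_left (h2 hxc) hx
      have := mul_le_mul_of_nonneg_right hs hu
      linarith

/-- Turns a strict inequality at zero dissipation into a positive threshold. -/
lemma exists_pos_of_continuous {F : ℝ → ℝ} (hF : Continuous F) {y : ℝ} (hy : y < F 0) :
    ∃ r, 0 < r ∧ ∀ D : ℝ, 0 ≤ D → D < r → y < F √D := by
  have hc : Continuous fun D : ℝ => F √D := hF.comp Real.continuous_sqrt
  have h0 : ∀ᶠ D in 𝓝 (0 : ℝ), y < F √D :=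
    hc.continuousAt.eventually (lt_mem_nhds (by simpa using hy))
  obtain ⟨r, hr, hr'⟩ := Metric.eventually_nhds_iff.mp h0
  exact ⟨r, hr, fun D hD hDr => hr' (by rwa [Real.dist_eq, sub_zero, abs_of_nonneg hD])⟩

lemma sq_sqrt_pow {x : ℝ} (hx : 0 ≤ x) (n : ℕ) : (√x ^ n) ^ 2 = x ^ n := by
  rw [← pow_mul, mul_comm, pow_mul, Real.sq_sqrt hx]

/-- Below the threshold, the indices in `s` alone would carry more mass than `ϱ`; the tail only adds
mass, so no moment is needed. -/
theorem exists_dissipation_bound_of_large_monomer (h : RatioBounds Q zs q) (hγ : γ ≤ 1)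
    (hC₁ : 0 < C₁) {x : ℝ} (hx : 0 ≤ x) {s : Finset ℕ+}
    (hs : ϱ < ∑ i ∈ s, ((i : ℕ) : ℝ) * Q i * x ^ (i : ℕ)) :
    ∃ ε, 0 < ε ∧ ∀ a b : ℕ+ → ℝ, IsAdmissible Q γ C₁ a b →
      ∀ c, IsPositiveWithMass c ϱ → x ≤ c 1 → ε ≤ lowerDissipation a Q c := by
  choose E hE using exists_root_bound h hγ hC₁ ϱ x
  obtain ⟨r, hr, hrD⟩ := exists_pos_of_continuous
    -- The truncation at `0` keeps squaring monotone when the lower bound is negative.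
    (F := fun t => ∑ i ∈ s, ((i : ℕ) : ℝ) * Q i * (max 0 (√x ^ (i : ℕ) - E i * t)) ^ 2)
    (y := ϱ) (by fun_prop) (by
      refine hs.trans_eq (Finset.sum_congr rfl fun i _ => ?_)
      rw [mul_zero, sub_zero, max_eq_right (by positivity), sq_sqrt_pow hx])
  refine ⟨r, hr, fun a b hab c hc hxc => ?_⟩
  by_contra! hlt
  refine (hrD _ (lowerDissipation_nonneg h hab) hlt).not_ge ?_
  refine le_trans (Finset.sum_le_sum fun i _ => ?_)
    (sum_le_hasSum s (fun i _ => by have := hc.pos i; positivity) hc.mass)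
  have hQi := h.pos i
  rw [mul_assoc]
  refine mul_le_mul_of_nonneg_left ?_ (cast_pos i).le
  rw [← mul_sq_sqrt_div (hc.pos i).le hQi]
  have := max_le (Real.sqrt_nonneg _) ((hE i a b hab c hc).1 hxc)
  gcongr

/-- Outside `s`, `i ≥ N` and `1 - β ≤ 0` give `i ≤ N ^ (1 - β) * i ^ β`. -/
lemma mass_le_partial_mass_add {β M N : ℝ} (hβ : 1 ≤ β) (hN : 0 < N) (hc : IsPositiveWithMass c ϱ)
    (hM : MomentLE c β M) {s : Finset ℕ+} (hs : ∀ i : ℕ+, ((i : ℕ) : ℝ) ≤ N → i ∈ s) :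
    ϱ ≤ ∑ i ∈ s, ((i : ℕ) : ℝ) * c i + N ^ (1 - β) * M := by
  have h1 := hasSum_sum_of_ne_finset_zero (s := s) (L := .unconditional ℕ+)
    (f := fun i => if i ∈ s then ((i : ℕ) : ℝ) * c i else 0) (fun i hi => by simp [hi])
  rw [Finset.sum_congr rfl (fun i hi => if_pos hi)] at h1
  have h2 := hM.summable.hasSum.mul_left (N ^ (1 - β))
  have h3 : ϱ ≤ ∑ i ∈ s, ((i : ℕ) : ℝ) * c i +
      N ^ (1 - β) * ∑' i : ℕ+, ((i : ℕ) : ℝ) ^ β * c i := by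
    refine hasSum_le (fun i => ?_) hc.mass (h1.add h2)
    have hci := hc.pos i
    have hi := cast_pos i
    by_cases his : i ∈ s
    · simp only [his, if_true]
      have : 0 ≤ N ^ (1 - β) * (((i : ℕ) : ℝ) ^ β * c i) := by positivity
      linarith
    · simp only [his, if_false, zero_add]
      have hNi : N ≤ ((i : ℕ) : ℝ) := le_of_lt (not_le.mp (mt (hs i) his))
      have : ((i : ℕ) : ℝ) ^ (1 - β) ≤ N ^ (1 - β) :=
        Real.rpow_le_rpow_of_nonpos hN hNi (by linarith)
      calc ((i : ℕ) : ℝ) * c i = ((i : ℕ) : ℝ) ^ (1 - β) * ((i : ℕ) : ℝ) ^ β * c i := by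
            rw [← Real.rpow_add hi, sub_add_cancel, Real.rpow_one]
        _ ≤ N ^ (1 - β) * ((i : ℕ) : ℝ) ^ β * c i := by gcongr
        _ = _ := by ring
  have : N ^ (1 - β) * ∑' i : ℕ+, ((i : ℕ) : ℝ) ^ β * c i ≤ N ^ (1 - β) * M := by
    have := hM.le
    gcongr
  linarith

/-- Below the threshold, the first `n` sizes carry little more than `ϱ'`, and the moment bound
leaves too little mass in the tail to reach `ϱ`. -/
theorem exists_dissipation_bound_of_small_monomer (h : RatioBounds Q zs q) (hγ : γ ≤ 1)
    (hC₁ : 0 < C₁) {β x ϱ' : ℝ} (M : ℝ) (hβ : 1 < β) (hx : IsEquilibriumDensity Q ϱ' x)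
    (hϱ' : ϱ' < ϱ) :
    ∃ ε, 0 < ε ∧ ∀ a b : ℕ+ → ℝ, IsAdmissible Q γ C₁ a b →
      ∀ c, IsPositiveWithMass c ϱ → MomentLE c β M → c 1 ≤ x → ε ≤ lowerDissipation a Q c := by
  choose E hE using exists_root_bound h hγ hC₁ ϱ x
  obtain ⟨n, hn⟩ : ∃ n : ℕ+, ((n : ℕ) : ℝ) ^ (1 - β) * M < ϱ - ϱ' := by
    have ht : Tendsto (fun n : ℕ => (n : ℝ) ^ (1 - β) * M) atTop (𝓝 0) := by
      have := ((tendsto_rpow_neg_atTop (show 0 < β - 1 by linarith)).comp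
        tendsto_natCast_atTop_atTop).mul_const M
      simpa [Function.comp_def] using this
    obtain ⟨n, hn, hn0⟩ := ((ht.eventually (gt_mem_nhds (show (0 : ℝ) < ϱ - ϱ' by linarith))).and
      (eventually_gt_atTop 0)).exists
    exact ⟨⟨n, hn0⟩, hn⟩
  set s : Finset ℕ+ := Finset.Icc 1 n with hs
  have hmem : ∀ i : ℕ+, ((i : ℕ) : ℝ) ≤ ((n : ℕ) : ℝ) → i ∈ s := fun i hi => by
    rw [hs, Finset.mem_Icc]
    exact ⟨one_le, by exact_mod_cast hi⟩
  obtain ⟨r, hr, hrD⟩ := exists_pos_of_continuous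
    (F := fun t => -∑ i ∈ s, ((i : ℕ) : ℝ) * Q i * (√x ^ (i : ℕ) + E i * t) ^ 2)
    (y := -(ϱ - ((n : ℕ) : ℝ) ^ (1 - β) * M)) (by fun_prop) (by
      have : ∑ i ∈ s, ((i : ℕ) : ℝ) * Q i * x ^ (i : ℕ) ≤ ϱ' :=
        sum_le_hasSum s (fun i _ => by have := h.pos i; have := hx.nonneg; positivity) hx.mass
      simp only [mul_zero, add_zero, sq_sqrt_pow hx.nonneg]
      linarith)
  refine ⟨r, hr, fun a b hab c hc hM hxc => ?_⟩
  by_contra! hlt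
  have h1 := hrD _ (lowerDissipation_nonneg h hab) hlt
  have h2 := mass_le_partial_mass_add hβ.le (cast_pos n) hc hM hmem
  have h3 : ∑ i ∈ s, ((i : ℕ) : ℝ) * c i ≤
      ∑ i ∈ s, ((i : ℕ) : ℝ) * Q i * (√x ^ (i : ℕ) + E i * √(lowerDissipation a Q c)) ^ 2 := by
    refine Finset.sum_le_sum fun i _ => ?_
    have hQi := h.pos i
    rw [mul_assoc]
    refine mul_le_mul_of_nonneg_left ?_ (cast_pos i).le
    rw [← mul_sq_sqrt_div (hc.pos i).le hQi]
    have := (hE i a b hab c hc).2 hxc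
    gcongr
  linarith

/-- For linear coagulation rates, no moment bound is needed when the monomer density is small. -/
theorem dissipation_bound_of_small_monomer (h : RatioBounds Q zs q) (hC₁ : 0 < C₁)
    (hab : IsAdmissible Q 1 C₁ a b) (hϱ : 0 < ϱ) (hc : IsPositiveWithMass c ϱ)
    (h1 : c 1 ≤ ϱ / 2) (h2 : c 1 ≤ zs / 16) :
    C₁ * zs * ϱ / 16 ≤ lowerDissipation a Q c := by
  have hzs := h.zs_pos
  obtain ⟨hfs, hfle⟩ := summable_rootFlux h le_rfl hC₁ hab hc
  have key : zs / 2 * (ϱ - ((1 : ℕ+) : ℕ) * c 1) ≤ 2 * c 1 * ϱ +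
      2 * ∑' i : ℕ+, ((i : ℕ) : ℝ) ^ (1 : ℝ) * (Q i * rootFlux Q c i ^ 2) := by
    refine hasSum_le (fun i => ?_) ((hasSum_pnat_shift hc.mass).mul_left (zs / 2))
      ((hc.mass.mul_left (2 * c 1)).add (hfs.hasSum.mul_left 2))
    have hQi := h.pos i
    have hQs := h.pos (i + 1)
    have hci := hc.pos i
    have hcs := hc.pos (i + 1)
    have hc1 := hc.pos 1
    have hi := one_le_cast i
    have e1 : zs * c (i + 1) ≤ Q i * √(c (i + 1) / Q (i + 1)) ^ 2 := by
      nth_rewrite 1 [← mul_sq_sqrt_div hcs.le hQs]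
      rw [← mul_assoc]
      have := h.upper i
      gcongr
    have e2 : Q i * √(c (i + 1) / Q (i + 1)) ^ 2 ≤
        2 * (c 1 * c i) + 2 * (Q i * rootFlux Q c i ^ 2) := by
      rw [sqrt_succ_eq hc.pos]
      have hy := mul_le_mul_of_nonneg_left (sub_sq_le_young (x := √(c 1) * √(c i / Q i))
        (y := rootFlux Q c i) one_pos) hQi.le
      have e3 : Q i * (√(c 1) * √(c i / Q i)) ^ 2 = c 1 * c i := by
        rw [mul_pow, Real.sq_sqrt hc1.le, mul_left_comm, mul_sq_sqrt_div hci.le hQi]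
      linarith
    rw [cast_succ, Real.rpow_one]
    -- Weighting by `i` costs a factor `2` against the mass weight `i + 1`; this is where `γ = 1`
    -- matters.
    have e4 : (((i : ℕ) : ℝ) + 1) * (zs * c (i + 1)) ≤ 2 * ((i : ℕ) : ℝ) * (zs * c (i + 1)) := by
      gcongr; linarith
    have e5 := mul_le_mul_of_nonneg_left (e1.trans e2) (cast_pos i).le
    linarith
  rw [PNat.one_coe, Nat.cast_one, one_mul] at key
  -- The left side is at least `zs * ϱ / 4` and the monomer term at most `zs * ϱ / 8`, so the flux
  -- term must supply the rest.
  have k1 : zs / 2 * (ϱ / 2) ≤ zs / 2 * (ϱ - c 1) := by gcongr; linarith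
  have k2 : 2 * c 1 * ϱ ≤ 2 * (zs / 16) * ϱ := by gcongr
  have k3 : zs * ϱ / 16 ≤ lowerDissipation a Q c / C₁ := by linarith
  rw [le_div_iff₀ hC₁] at k3
  linarith

end Extremes

end BeckerDoring

/-! ### The main theorem -/

open BeckerDoring in
theorem theorem1p1
    (Q α : ℕ+ → ℝ) (zs ϱ : ℝ)
    (hzs_pos : 0 < zs)
    (hzs : criticalMonomerDensity Q = ENNReal.ofReal zs)
    (hQ : HasTypicalForm Q α zs)
    (hϱ_pos : 0 < ϱ)
    (hϱ : ENNReal.ofReal ϱ < criticalMass Q) :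
    -- the equilibrium with mass `ϱ` exists and is unique
    (∃! z : ℝ, IsEquilibriumDensity Q ϱ z) ∧
    -- the series that define the two functionals converge
    (∀ zbar : ℝ, IsEquilibriumDensity Q ϱ zbar →
      ∀ γ C₁ : ℝ, 0 ≤ γ → γ ≤ 1 → 0 < C₁ →
      ∀ a b : ℕ+ → ℝ, IsAdmissible Q γ C₁ a b →
      ∀ c : ℕ+ → ℝ, IsPositiveWithMass c ϱ →
        Summable (lowerDissipationTerm a Q c) ∧
        Summable (freeEnergyTerm Q zbar c) ∧
        Summable (fun i : ℕ+ => zbar ^ (i : ℕ) * Q i)) ∧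
    -- (i) the case `γ = 1`
    (∀ zbar : ℝ, IsEquilibriumDensity Q ϱ zbar →
      ∀ δ C₁ : ℝ, 0 < δ → 0 < C₁ →
      ∃ K : ℝ, 0 < K ∧
        ∀ a b : ℕ+ → ℝ, IsAdmissible Q 1 C₁ a b →
        ∀ c : ℕ+ → ℝ, IsPositiveWithMass c ϱ →
          δ < c 1 → c 1 < zs - δ →
          K * relativeFreeEnergy Q zbar c ≤ lowerDissipation a Q c) ∧
    -- (ii) the case `γ < 1`
    (∀ zbar : ℝ, IsEquilibriumDensity Q ϱ zbar →
      ∀ δ C₁ γ β M : ℝ, 0 < δ → 0 < C₁ → 0 ≤ γ → γ < 1 → 1 < β →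
      ∃ K : ℝ, 0 < K ∧
        ∀ a b : ℕ+ → ℝ, IsAdmissible Q γ C₁ a b →
        ∀ c : ℕ+ → ℝ, IsPositiveWithMass c ϱ → MomentLE c β M →
          δ < c 1 → c 1 < zs - δ →
          K * relativeFreeEnergy Q zbar c ^ ((β - γ) / (β - 1)) ≤ lowerDissipation a Q c) ∧
    -- (iii) `c 1` outside of the good range
    (∃ δ₀ : ℝ, 0 < δ₀ ∧ ∀ δ : ℝ, 0 < δ → δ ≤ δ₀ → ∀ C₁ : ℝ, 0 < C₁ →
      (∃ ε : ℝ, 0 < ε ∧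
        ∀ a b : ℕ+ → ℝ, IsAdmissible Q 1 C₁ a b →
        ∀ c : ℕ+ → ℝ, IsPositiveWithMass c ϱ →
          (c 1 ≤ δ ∨ zs - δ ≤ c 1) →
          ε ≤ lowerDissipation a Q c) ∧
      (∀ γ β M : ℝ, 0 ≤ γ → γ < 1 → 1 < β →
        ∃ ε : ℝ, 0 < ε ∧
          ∀ a b : ℕ+ → ℝ, IsAdmissible Q γ C₁ a b →
          ∀ c : ℕ+ → ℝ, IsPositiveWithMass c ϱ → MomentLE c β M →
            (c 1 ≤ δ ∨ zs - δ ≤ c 1) →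
            ε ≤ lowerDissipation a Q c)) := by
  obtain ⟨q, h⟩ := hQ.exists_ratioBounds hzs_pos
  rw [criticalMass, hzs] at hϱ
  obtain ⟨z₀, hz₀, hz₀s, hz₀m⟩ := h.exists_equilibrium hϱ_pos hϱ
  refine ⟨⟨z₀, hz₀m, fun z hz => h.isEquilibriumDensity_unique hz hz₀m⟩, ?_, ?_, ?_, ?_⟩
  · intro zbar hzb γ C₁ _ hγ1 _ a b hab c hc
    obtain rfl := h.isEquilibriumDensity_unique hzb hz₀m
    exact ⟨summable_lowerDissipationTerm h hγ1 hab hc,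
      summable_freeEnergyTerm h hϱ_pos hc hz₀ hz₀s, h.summable_equilibrium hz₀.le hz₀s⟩
  · intro zbar hzb δ C₁ hδ hC₁
    obtain rfl := h.isEquilibriumDensity_unique hzb hz₀m
    exact exists_linear_entropy_dissipation h hϱ_pos hzb hz₀ hz₀s hδ hC₁
  · intro zbar hzb δ C₁ γ β M hδ hC₁ hγ0 hγ1 hβ
    obtain rfl := h.isEquilibriumDensity_unique hzb hz₀m
    exact exists_algebraic_entropy_dissipation h hϱ_pos M hzb hz₀ hz₀s hδ hC₁ hγ0 hγ1 hβ
  -- Equilibria with densities on either side of `z₀` have masses strictly above and below `ϱ`; they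
  -- serve as barriers for large and small `c 1`.
  have hx0 : 0 ≤ (z₀ + zs) / 2 := by linarith
  obtain ⟨ϱ₁, hϱ₁⟩ := h.exists_isEquilibriumDensity hx0 (by linarith : (z₀ + zs) / 2 < zs)
  obtain ⟨s, hs⟩ := (hϱ₁.mass.eventually
    (lt_mem_nhds (h.mass_strictMono hz₀m hϱ₁ (by linarith)))).exists
  obtain ⟨ϱ₂, hϱ₂⟩ :=
    h.exists_isEquilibriumDensity (half_pos hz₀).le (by linarith : z₀ / 2 < zs)
  have hϱ₂lt := h.mass_strictMono hϱ₂ hz₀m (by linarith)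
  -- The first two terms push `c 1` beyond the barriers `(z₀ + zs) / 2` and `z₀ / 2`; the last two
  -- are required by the small-monomer bound for `γ = 1`.
  refine ⟨min ((zs - z₀) / 2) (min (z₀ / 2) (min (zs / 16) (ϱ / 2))),
    by have := sub_pos.mpr hz₀s; positivity, fun δ _ hδ C₁ hC₁ => ?_⟩
  simp only [le_min_iff] at hδ
  obtain ⟨hδ1, hδ2, hδ3, hδ4⟩ := hδ
  refine ⟨?_, fun γ β M _ hγ1 hβ => ?_⟩
  · obtain ⟨ε, hε, hbig⟩ :=
      exists_dissipation_bound_of_large_monomer h le_rfl hC₁ hx0 hs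
    refine ⟨min ε (C₁ * zs * ϱ / 16), by positivity, fun a b hab c hc hc1 => ?_⟩
    rcases hc1 with hc1 | hc1
    · exact (min_le_right _ _).trans (dissipation_bound_of_small_monomer h hC₁ hab hϱ_pos hc
        (hc1.trans hδ4) (hc1.trans hδ3))
    · exact (min_le_left _ _).trans (hbig a b hab c hc (by linarith))
  · obtain ⟨ε, hε, hbig⟩ :=
      exists_dissipation_bound_of_large_monomer h hγ1.le hC₁ hx0 hs
    obtain ⟨ε', hε', hsmall⟩ :=
      exists_dissipation_bound_of_small_monomer h hγ1.le hC₁ M hβ hϱ₂ hϱ₂lt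
    refine ⟨min ε ε', by positivity, fun a b hab c hc hM hc1 => ?_⟩
    rcases hc1 with hc1 | hc1
    · exact (min_le_right _ _).trans (hsmall a b hab c hc hM (hc1.trans hδ2))
    · exact (min_le_left _ _).trans (hbig a b hab c hc (by linarith))
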